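/- **Setting.** In the Evans unrelated-confounders (UC) scenario three observed bits $A,B,C$ and two independent latent sources $\gamma,\alpha$ are connected by $B\to A$, $B\to C$, $\gamma\to A$, $\gamma\to B$, $\alpha\to B$, $\alpha\to C$. A classical model consists of independent random latent variables $\gamma,\alpha$ (with values in arbitrary measurable spaces) and response probabilities $p_A(a|b,\gamma)$, $p_B(b|\gamma,\alpha)$, $p_C(c|b,\alpha)$. It yields $P_{ABC}(a,b,c)=\mathbb E[p_A(a|b,\gamma)p_B(b|\gamma,\alpha)p_C(c|b,\alpha)]$ and, on the interrupted graph where $A$ and $C$ respond to an exogenous value $s$ of $B^{\#}$, $Q_{ABC|B^\#}(a,b,c|s)=\mathbb E[p_A(a|s,\gamma)p_B(b|\gamma,\alpha)p_C(c|s,\alpha)]$; the interventional tables $P_A(a|do(B=s))$, $P_C(c|do(B=s))$, $P_{AC}(a,c|do(B=s))$ are the marginals of $Q(\cdot|s)$. In a quantum strategy, $\gamma$ and $\alpha$ are density matrices $\psi_{AB},\psi_{BC}$, the responses are POVMs $E_{a|b},E_b,E_{c|b}$, and $P_{ABC}(a,b,c)=\mathrm{Tr}[(\psi_{AB}\otimes\psi_{BC})(E_{a|b}\otimes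 E_b\otimes E_{c|b})]$, $P_A(a|do(B=b))=\mathrm{Tr}[\psi_{AB}(E_{a|b}\otimes 1)]$, $P_C(c|do(B=b))=\mathrm{Tr}[\psi_{BC}(1\otimes E_{c|b})]$. **Theorem.** For $0\le v\le 1$ consider the following strategy. $A$ and $B$ share the Werner state $v|\phi^+\rangle\langle\phi^+|+(1-v)\frac{1}{4}\mathbb 1$ with $|\phi^+\rangle=\frac1{\sqrt2}(|00\rangle+|11\rangle)$; $\alpha$ is a uniform classical bit sent to $B$ and $C$; $C$ outputs $c=\alpha$; $B$ measures $\frac1{\sqrt2}(\sigma_x+(-1)^\alpha\sigma_z)$ and outputs $b$; $A$ measures $\sigma_x$ if $b=0$ and $\sigma_z$ if $b=1$ (outcome $k\in\{0,1\}$ stands for the eigenvalue $(-1)^k$). 1. This is a valid quantum strategy, and $$P^v_{ABC}(a,b,c)=\tfrac18\Big[1+\tfrac{v}{\sqrt2}(-1)^{a+b+cb}\Big],\qquad P_A(a|do(B=b))=P_C(c|do(B=b))=\tfrac12 .$$ 2. For every $\frac1{\sqrt2}<v\le1$ these data tables exhibit non-classicality from data fusion. Each of $P^v_{ABC}$, $P_{A|do(B)}$,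 $P_{C|do(B)}$, and also $P_{AC|do(B)}=P_{A|do(B)}P_{C|do(B)}$, is separately reproduced by a classical model, even one with finitely many values of the latent variables. But there is no classical model whose distribution $Q$ on the interrupted graph satisfies simultaneously $Q(a,b,c|b)=P^v_{ABC}(a,b,c)$, $Q_{A|B^\#}(a|s)=P_A(a|do(B=s))$ and $Q_{C|B^\#}(c|s)=P_C(c|do(B=s))$. 3. Put $$I=2P_{AB}(0,0)+P_B(1)+P_{BC}(1,0)+P_{ABC}(0,1,1)-2P_{ABC}(0,1,0),$$ $$J=P_{AB}(0,0)-2P_{AB}(1,0)-2P_{ABC}(0,1,0),$$ $$E=2P_{AB}(0,1)P_{BC}(1,0)+P_{AB}(0,0)P_{AB}(1,0)-P_{ABC}(0,1,0)^2+\big(P_{AB}(1,0)+P_B(0)\big)\big(P_{BC}(1,0)+P_{ABC}(0,1,1)\big),$$ $$\beta=P_A(0|do(B=0))^2-P_A(0|do(B=0))\,I+E+J .$$ Then $\beta\le0$ for every classical model. More generally, $\beta\le0$ (with $P_{ABC}(a,b,c)=Q(a,b,c|b)$ and $P_A(a|do(B=s))=Q_{A|B^\#}(a|s)$) for every conditional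 distribution $Q_{ABC|B^\#}$ that admits a second-order inflation, i.e. a probability distribution $q$ of bits $A^i_s,B^{ij},C^j_s$ ($i,j,s\in\{0,1\}$), invariant under exchanging the two values of the copy index $i$ and under exchanging the two values of the copy index $j$, with $q(A^0_{s_0}=a_0,A^1_{s_1}=a_1,B^{00}=b_0,B^{11}=b_1,C^0_{s_0}=c_0,C^1_{s_1}=c_1)=Q(a_0,b_0,c_0|s_0)\,Q(a_1,b_1,c_1|s_1)$ for all values. For the strategy above with $v=1$, $\beta=\frac1{128}(38\sqrt2-53)>0$. -/

import Mathlib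

open MeasureTheory
open scoped Kronecker ComplexOrder

universe u w

noncomputable section

namespace UC

/-! All observed variables `A`, `B`, `C` are bits.  The causal structure has the observed edges
`B → A`, `B → C`, a latent source `γ` feeding `A` and `B`, and an independent latent source `α`
feeding `B` and `C`. -/

/-- Observational table: `P a b c = P_{ABC}(a, b, c)`. -/
abbrev ObsTable := Fin 2 → Fin 2 → Fin 2 → ℝ

/-- Interventional table of one variable: `T x b = P_X(x | do(B = b))`. -/
abbrev DoTable := Fin 2 → Fin 2 → ℝ

/-- Table on the interrupted graph: `Q a b c s = Q_{ABC|B#}(a, b, c | s)`. -/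
abbrev SwigTable := Fin 2 → Fin 2 → Fin 2 → Fin 2 → ℝ

/-! ### Classical models -/

/-- A classical causal model: two independent latent variables `γ`, `α` with values in arbitrary
measurable spaces, and stochastic response functions for the observed nodes. -/
structure ClassicalModel (Γ : Type u) (Λ : Type w) [MeasurableSpace Γ] [MeasurableSpace Λ] where
  /-- law of `γ` -/
  μ : ProbabilityMeasure Γ
  /-- law of `α` -/
  ν : ProbabilityMeasure Λ
  /-- `pA b γ a` is `p_A(a | b, γ)` -/
  pA : Fin 2 → Γ → Fin 2 → ℝ
  /-- `pB γ α b` is `p_B(b | γ, α)` -/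
  pB : Γ → Λ → Fin 2 → ℝ
  /-- `pC b α c` is `p_C(c | b, α)` -/
  pC : Fin 2 → Λ → Fin 2 → ℝ
  measurable_pA : ∀ b a, Measurable fun γ => pA b γ a
  measurable_pB : ∀ b, Measurable fun x : Γ × Λ => pB x.1 x.2 b
  measurable_pC : ∀ b c, Measurable fun α => pC b α c
  pA_nonneg : ∀ b γ a, 0 ≤ pA b γ a
  pB_nonneg : ∀ γ α b, 0 ≤ pB γ α b
  pC_nonneg : ∀ b α c, 0 ≤ pC b α c
  pA_sum : ∀ b γ, ∑ a, pA b γ a = 1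
  pB_sum : ∀ γ α, ∑ b, pB γ α b = 1
  pC_sum : ∀ b α, ∑ c, pC b α c = 1

section Model

variable {Γ : Type u} {Λ : Type w} [MeasurableSpace Γ] [MeasurableSpace Λ]

/-- The observational distribution of a classical model. -/
def ClassicalModel.obs (M : ClassicalModel Γ Λ) : ObsTable := fun a b c =>
  ∫ γ, ∫ α, M.pA b γ a * M.pB γ α b * M.pC b α c ∂(M.ν : Measure Λ) ∂(M.μ : Measure Γ)

/-- The distribution of a classical model on the interrupted graph, where `A` and `C` react to
the exogenous value `s` of `B#` in place of `b`. -/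
def ClassicalModel.swig (M : ClassicalModel Γ Λ) : SwigTable := fun a b c s =>
  ∫ γ, ∫ α, M.pA s γ a * M.pB γ α b * M.pC s α c ∂(M.ν : Measure Λ) ∂(M.μ : Measure Γ)

end Model

/-- Observational part of a table on the interrupted graph (`B# = B`). -/
def SwigTable.obs (Q : SwigTable) : ObsTable := fun a b c => Q a b c b

/-- The marginal of `A` and `C` given `B#`. -/
def SwigTable.doAC (Q : SwigTable) (a c s : Fin 2) : ℝ := ∑ b, Q a b c s

/-- The marginal of `A` given `B#`. -/
def SwigTable.doA (Q : SwigTable) : DoTable := fun a s => ∑ b, ∑ c, Q a b c s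

/-- The marginal of `C` given `B#`. -/
def SwigTable.doC (Q : SwigTable) : DoTable := fun c s => ∑ a, ∑ b, Q a b c s

/-- For each value of `B#`, `Q` is a probability distribution of `(A, B, C)`. -/
def SwigTable.IsCondDist (Q : SwigTable) : Prop :=
  (∀ a b c s, 0 ≤ Q a b c s) ∧ ∀ s, ∑ a, ∑ b, ∑ c, Q a b c s = 1

/-- `Q` arises from a classical model on the interrupted graph, with arbitrary latent spaces. -/
def SwigTable.IsClassical (Q : SwigTable) : Prop :=
  ∃ (Γ : Type u) (Λ : Type w) (_ : MeasurableSpace Γ) (_ : MeasurableSpace Λ)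
    (M : ClassicalModel Γ Λ), Q = M.swig

/-- The tables are non-classical from data fusion: individually they have classical models (even
with finite latent variables), but no classical model on the interrupted graph, with whatever
latent spaces, is consistent with all of them. -/
structure NonClassicalFusion (P : ObsTable) (TA TC : DoTable) : Prop where
  obs_classical : ∃ (m n : ℕ) (M : ClassicalModel (Fin m) (Fin n)), M.obs = P
  doA_classical : ∃ (m n : ℕ) (M : ClassicalModel (Fin m) (Fin n)), M.swig.doA = TA
  doC_classical : ∃ (m n : ℕ) (M : ClassicalModel (Fin m) (Fin n)), M.swig.doC = TC
  /-- The joint interventional table `P_{AC|do(B)} = P_{A|do(B)} P_{C|do(B)}` is classical too. -/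
  doAC_classical : ∃ (m n : ℕ) (M : ClassicalModel (Fin m) (Fin n)),
    ∀ a c s, M.swig.doAC a c s = TA a s * TC c s
  joint_nonclassical : ¬ ∃ Q : SwigTable,
    SwigTable.IsClassical.{u, w} Q ∧ Q.obs = P ∧ Q.doA = TA ∧ Q.doC = TC

/-! ### Quantum strategies -/

/-- The data of a quantum strategy: the source `γ` sends systems `X`, `Y` to `A`, `B`, the source
`α` sends systems `Z`, `W` to `B`, `C`; all dimensions are finite. -/
structure QuantumStrategy (X Y Z W : Type) where
  ψAB : Matrix (X × Y) (X × Y) ℂ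
  ψBC : Matrix (Z × W) (Z × W) ℂ
  /-- `EA b a` is the effect `E_{a|b}` -/
  EA : Fin 2 → Fin 2 → Matrix X X ℂ
  EB : Fin 2 → Matrix (Y × Z) (Y × Z) ℂ
  /-- `EC b c` is the effect `E_{c|b}` -/
  EC : Fin 2 → Fin 2 → Matrix W W ℂ

namespace QuantumStrategy

variable {X Y Z W : Type} [Fintype X] [Fintype Y] [Fintype Z] [Fintype W]
  [DecidableEq X] [DecidableEq Y] [DecidableEq Z] [DecidableEq W]

/-- The sources are density matrices and the measurements are POVMs. -/
structure IsValid (S : QuantumStrategy X Y Z W) : Prop where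
  ψAB_psd : S.ψAB.PosSemidef
  ψAB_trace : S.ψAB.trace = 1
  ψBC_psd : S.ψBC.PosSemidef
  ψBC_trace : S.ψBC.trace = 1
  EA_psd : ∀ b a, (S.EA b a).PosSemidef
  EA_sum : ∀ b, ∑ a, S.EA b a = 1
  EB_psd : ∀ b, (S.EB b).PosSemidef
  EB_sum : ∑ b, S.EB b = 1
  EC_psd : ∀ b c, (S.EC b c).PosSemidef
  EC_sum : ∀ b, ∑ c, S.EC b c = 1

/-- Born rule `Tr((ψ_AB ⊗ ψ_BC)(E_{a|b} ⊗ E_b ⊗ E_{c|b}))`; the `submatrix` only rebrackets the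
tensor factors. -/
def obs (S : QuantumStrategy X Y Z W) : ObsTable := fun a b c =>
  (((S.ψAB ⊗ₖ S.ψBC) *
    (S.EA b a ⊗ₖ (S.EB b ⊗ₖ S.EC b c)).submatrix
      (fun p : (X × Y) × (Z × W) => (p.1.1, ((p.1.2, p.2.1), p.2.2)))
      (fun p : (X × Y) × (Z × W) => (p.1.1, ((p.1.2, p.2.1), p.2.2)))).trace).re

/-- `P_A(a | do(B = b)) = Tr(ψ_AB (E_{a|b} ⊗ 1))`. -/
def doA (S : QuantumStrategy X Y Z W) : DoTable := fun a b =>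
  ((S.ψAB * (S.EA b a ⊗ₖ (1 : Matrix Y Y ℂ))).trace).re

/-- `P_C(c | do(B = b)) = Tr(ψ_BC (1 ⊗ E_{c|b}))`. -/
def doC (S : QuantumStrategy X Y Z W) : DoTable := fun c b =>
  ((S.ψBC * ((1 : Matrix Z Z ℂ) ⊗ₖ S.EC b c)).trace).re

end QuantumStrategy

/-- Pauli matrix `σ_x`. -/
def σx : Matrix (Fin 2) (Fin 2) ℂ := !![0, 1; 1, 0]

/-- Pauli matrix `σ_z`. -/
def σz : Matrix (Fin 2) (Fin 2) ℂ := !![1, 0; 0, -1]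

/-- The vector `(|00⟩ + |11⟩)/√2`. -/
def phiPlus : Fin 2 × Fin 2 → ℂ := fun p => if p.1 = p.2 then ((1 / √2 : ℝ) : ℂ) else 0

/-- The Werner state of visibility `v`. -/
def werner (v : ℝ) : Matrix (Fin 2 × Fin 2) (Fin 2 × Fin 2) ℂ :=
  (v : ℂ) • Matrix.vecMulVec phiPlus (star phiPlus) + (((1 - v) / 4 : ℝ) : ℂ) • 1

/-- For an observable `O` with `O² = 1`, the projector on the eigenvalue `(-1)^k`, which is
read as outcome `k`. -/
def outcomeProj (O : Matrix (Fin 2) (Fin 2) ℂ) (k : Fin 2) : Matrix (Fin 2) (Fin 2) ℂ :=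
  (1 / 2 : ℂ) • (1 + (-1 : ℂ) ^ (k : ℕ) • O)

/-- `A` measures `σ_x` if `b = 0` and `σ_z` if `b = 1`. -/
def obsA (b : Fin 2) : Matrix (Fin 2) (Fin 2) ℂ := if b = 0 then σx else σz

/-- `B` measures `(σ_x + (-1)^α σ_z)/√2`. -/
def obsB (α : Fin 2) : Matrix (Fin 2) (Fin 2) ℂ :=
  ((1 / √2 : ℝ) : ℂ) • (σx + (-1 : ℂ) ^ (α : ℕ) • σz)

/-- `|k⟩⟨k|`. -/
def ketbra (k : Fin 2) : Matrix (Fin 2) (Fin 2) ℂ := Matrix.single k k 1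

/-- The strategy: a Werner state between `A` and `B`, a uniform classical bit `α` sent to `B` and
`C` (the state `½ ∑_α |α⟩⟨α| ⊗ |α⟩⟨α|`), which `B` reads to choose the measurement and which `C`
outputs. -/
def strategy (v : ℝ) : QuantumStrategy (Fin 2) (Fin 2) (Fin 2) (Fin 2) where
  ψAB := werner v
  ψBC := ∑ α, (1 / 2 : ℂ) • (ketbra α ⊗ₖ ketbra α)
  EA b a := outcomeProj (obsA b) a
  EB b := ∑ α, outcomeProj (obsB α) b ⊗ₖ ketbra α
  EC _ c := ketbra c

/-! ### The quadratic witness and second-order inflation -/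

/-- `P_{AB}` -/
def margAB (P : ObsTable) (a b : Fin 2) : ℝ := ∑ c, P a b c

/-- `P_{BC}` -/
def margBC (P : ObsTable) (b c : Fin 2) : ℝ := ∑ a, P a b c

/-- `P_B` -/
def margB (P : ObsTable) (b : Fin 2) : ℝ := ∑ a, ∑ c, P a b c

/-- The linear quantity that multiplies `P_A(0 | do(B = 0))` in the witness. -/
def witnessI (P : ObsTable) : ℝ :=
  2 * margAB P 0 0 + margB P 1 + margBC P 1 0 + P 0 1 1 - 2 * P 0 1 0

/-- The linear terms of the witness. -/
def witnessJ (P : ObsTable) : ℝ := margAB P 0 0 - 2 * margAB P 1 0 - 2 * P 0 1 0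

/-- The quadratic terms of the witness. -/
def witnessE (P : ObsTable) : ℝ :=
  2 * margAB P 0 1 * margBC P 1 0 + margAB P 0 0 * margAB P 1 0 - P 0 1 0 ^ 2
    + (margAB P 1 0 + margB P 0) * (margBC P 1 0 + P 0 1 1)

/-- The quadratic witness, a function of `P_{ABC}` and `P_{A|do(B)}`. -/
def witness (P : ObsTable) (TA : DoTable) : ℝ :=
  TA 0 0 ^ 2 - TA 0 0 * witnessI P + witnessE P + witnessJ P

/-- `Q` admits a second-order inflation: a distribution `q` of bits `A i s`, `B i j`, `C j s`,
where `i` and `j` index two copies of the sources `γ` and `α` and `s` is a value of `B#`, which is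
invariant under the exchange of the two copies of either source, and in which the diagonal copies
reproduce the products of two entries of `Q`. -/
def SwigTable.HasSecondOrderInflation (Q : SwigTable) : Prop :=
  ∃ q : (Fin 2 → Fin 2 → Fin 2) → (Fin 2 → Fin 2 → Fin 2) → (Fin 2 → Fin 2 → Fin 2) → ℝ,
    (∀ A B C, 0 ≤ q A B C) ∧
    (∑ A, ∑ B, ∑ C, q A B C = 1) ∧
    (∀ A B C, q (fun i => A (1 - i)) (fun i => B (1 - i)) C = q A B C) ∧
    (∀ A B C, q A (fun i j => B i (1 - j)) (fun j => C (1 - j)) = q A B C) ∧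
    (∀ s₀ s₁ a₀ a₁ b₀ b₁ c₀ c₁ : Fin 2,
      (∑ A, ∑ B, ∑ C,
        if A 0 s₀ = a₀ ∧ A 1 s₁ = a₁ ∧ B 0 0 = b₀ ∧ B 1 1 = b₁ ∧ C 0 s₀ = c₀ ∧ C 1 s₁ = c₁
        then q A B C else 0) = Q a₀ b₀ c₀ s₀ * Q a₁ b₁ c₁ s₁)

end UC

end

namespace UC
-- Joint non-classicality: the observational table fixes `Q(a,b,c|s)` only for `b = s`, but the
-- interventional tables supply what is missing. For `s = 0`, the uniform marginal of `A` yields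
-- `Q_{AB}(a,1|0)`. For `s = 1`, `A` and `C` are independent on the interrupted graph
-- (`swig_doAC_eq`), hence jointly uniform, which yields `Q(a,0,c|1)`. With outcomes read as signs,
-- the Bell expression `E[A B | s=0] + E[A B C | s=1]` then equals `2v/√2`. Classically it is at
-- most 1 (`bell_inequality`): under `s = 1`, `C` is a fair sign independent of `γ`, so it plays the
-- role of a random setting for `B`. Hence the threshold `v > 1/√2`. Separately, the interventional
-- tables are those of fair coins, and `P_{ABC}` comes from selection on `B` (`selectionModel`).
--
-- Quadratic inequality: `β` is a bilinear form evaluated on two independent copies of `Q`. In an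
-- inflation this is the mean of a function of the twelve bits. By exchange invariance the function
-- may be averaged over the four exchanges of source copies, and that average is nonpositive on
-- every deterministic assignment, a finite check (`bilinearWitness_symm_nonpos`). A classical model
-- has an inflation because its sources can be copied independently (`hasSecondOrderInflation`).
-- Validity of the quantum strategy
theorem σx_sq : σx * σx = 1 := by
  ext i j; fin_cases i <;> fin_cases j <;> simp [σx, Matrix.mul_apply]

theorem σz_sq : σz * σz = 1 := by
  ext i j; fin_cases i <;> fin_cases j <;> simp [σz, Matrix.mul_apply]

theorem σx_isHermitian : σx.IsHermitian := by
  ext i j; fin_cases i <;> fin_cases j <;> simp [σx]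

theorem σz_isHermitian : σz.IsHermitian := by
  ext i j; fin_cases i <;> fin_cases j <;> simp [σz]

theorem neg_one_pow_mul_self (k : ℕ) : (-1 : ℂ) ^ k * (-1 : ℂ) ^ k = 1 := by
  rw [← mul_pow]; simp

theorem ofReal_inv_sqrt_two_mul_self :
    ((1 / √2 : ℝ) : ℂ) * ((1 / √2 : ℝ) : ℂ) = 1 / 2 := by
  rw [← Complex.ofReal_mul, div_mul_div_comm, Real.mul_self_sqrt (by norm_num)]
  norm_num

theorem obsA_sq (b : Fin 2) : obsA b * obsA b = 1 := by
  unfold obsA; split_ifs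
  exacts [σx_sq, σz_sq]

theorem obsA_isHermitian (b : Fin 2) : (obsA b).IsHermitian := by
  unfold obsA; split_ifs
  exacts [σx_isHermitian, σz_isHermitian]

/-- The Pauli matrices `σx` and `σz` anticommute, so the cross terms cancel and the square is `2 r²
= 1` with `r = 1/√2`. -/
theorem obsB_sq (α : Fin 2) : obsB α * obsB α = 1 := by
  have h := ofReal_inv_sqrt_two_mul_self
  unfold obsB
  generalize ((1 / √2 : ℝ) : ℂ) = r at h
  ext i j
  fin_cases α <;> fin_cases i <;> fin_cases j <;>
    simp [σx, σz, Matrix.mul_apply] <;> linear_combination 2 * h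

theorem obsB_isHermitian (α : Fin 2) : (obsB α).IsHermitian := by
  have h : star ((-1 : ℂ) ^ (α : ℕ)) = (-1) ^ (α : ℕ) := by simp
  unfold obsB Matrix.IsHermitian
  rw [Matrix.conjTranspose_smul, Matrix.conjTranspose_add, Matrix.conjTranspose_smul,
    σx_isHermitian.eq, σz_isHermitian.eq, h]
  simp

/-- A Hermitian idempotent `P` equals `Pᴴ * P`. -/
theorem outcomeProj_posSemidef {O : Matrix (Fin 2) (Fin 2) ℂ} (hO : O.IsHermitian)
    (hsq : O * O = 1) (k : Fin 2) : (outcomeProj O k).PosSemidef := by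
  have hH : (outcomeProj O k).conjTranspose = outcomeProj O k := by
    have h : star ((-1 : ℂ) ^ (k : ℕ)) = (-1) ^ (k : ℕ) := by simp
    unfold outcomeProj
    rw [Matrix.conjTranspose_smul, Matrix.conjTranspose_add, Matrix.conjTranspose_smul, hO.eq, h]
    simp
  have hP : outcomeProj O k * outcomeProj O k = outcomeProj O k := by
    have h := neg_one_pow_mul_self (k : ℕ)
    unfold outcomeProj
    generalize (-1 : ℂ) ^ (k : ℕ) = e at h
    have h' : (e • O) * (e • O) = 1 := by rw [smul_mul_smul_comm, h, hsq, one_smul]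
    rw [smul_mul_smul_comm, add_mul, mul_add, mul_add, h', one_mul, mul_one, one_mul]
    module
  rw [← hP]
  nth_rewrite 1 [← hH]
  exact Matrix.posSemidef_conjTranspose_mul_self _

theorem sum_outcomeProj (O : Matrix (Fin 2) (Fin 2) ℂ) : ∑ k, outcomeProj O k = 1 := by
  simp only [outcomeProj, Fin.sum_univ_two, Fin.val_zero, Fin.val_one, pow_zero, pow_one]
  module

theorem ketbra_posSemidef (k : Fin 2) : (ketbra k).PosSemidef := by
  have h : (ketbra k).conjTranspose * ketbra k = ketbra k := by
    simp [ketbra]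
  rw [← h]
  exact Matrix.posSemidef_conjTranspose_mul_self _

theorem sum_ketbra : ∑ k, ketbra k = 1 := by
  ext i j; fin_cases i <;> fin_cases j <;> simp [ketbra, Fin.sum_univ_two]

theorem werner_posSemidef {v : ℝ} (h0 : 0 ≤ v) (h1 : v ≤ 1) : (werner v).PosSemidef := by
  refine .add (.smul (Matrix.posSemidef_vecMulVec_self_star _) (by exact_mod_cast h0))
    (.smul .one ?_)
  have : 0 ≤ (1 - v) / 4 := by linarith
  exact_mod_cast this

/-- The entries of the Werner state. -/
theorem werner_apply (v : ℝ) (p q : Fin 2 × Fin 2) :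
    werner v p q = (if p.1 = p.2 ∧ q.1 = q.2 then (v / 2 : ℂ) else 0) +
      if p = q then ((1 - v) / 4 : ℂ) else 0 := by
  have h := ofReal_inv_sqrt_two_mul_self
  simp only [werner, Matrix.add_apply, Matrix.smul_apply, Matrix.vecMulVec_apply, phiPlus,
    Pi.star_apply, Matrix.one_apply, smul_eq_mul]
  congr 1
  · by_cases hp : p.1 = p.2 <;> by_cases hq : q.1 = q.2 <;> simp only [hp, hq, if_true, if_false,
      and_self, and_true, and_false, star_zero, mul_zero, zero_mul]
    rw [Complex.star_def, Complex.conj_ofReal, h]; ring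
  · split_ifs <;> simp

theorem strategy_isValid {v : ℝ} (h0 : 0 ≤ v) (h1 : v ≤ 1) : (strategy v).IsValid where
  ψAB_psd := werner_posSemidef h0 h1
  ψAB_trace := by
    simp [strategy, Matrix.trace, werner_apply, Fintype.sum_prod_type]
    ring
  ψBC_psd := Matrix.posSemidef_sum _ fun α _ =>
    ((ketbra_posSemidef α).kronecker (ketbra_posSemidef α)).smul (by positivity)
  ψBC_trace := by
    simp [strategy, Matrix.trace_kronecker, ketbra]
    norm_num
  EA_psd b a := outcomeProj_posSemidef (obsA_isHermitian b) (obsA_sq b) a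
  EA_sum b := sum_outcomeProj _
  EB_psd b := Matrix.posSemidef_sum _ fun α _ =>
    (outcomeProj_posSemidef (obsB_isHermitian α) (obsB_sq α) b).kronecker (ketbra_posSemidef α)
  EB_sum := by
    simp only [strategy]
    rw [Finset.sum_comm]
    have h (α : Fin 2) : ∑ b, outcomeProj (obsB α) b ⊗ₖ ketbra α = 1 ⊗ₖ ketbra α := by
      rw [Fin.sum_univ_two, ← Matrix.add_kronecker, ← sum_outcomeProj (obsB α), Fin.sum_univ_two]
    simp only [h]
    rw [Fin.sum_univ_two, ← Matrix.kronecker_add, ← Fin.sum_univ_two ketbra, sum_ketbra,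
      Matrix.one_kronecker_one]
  EC_psd _ c := ketbra_posSemidef c
  EC_sum _ := sum_ketbra

/-! ### Born-rule tables of the strategy -/

/-- Correlations in the Werner state. -/
theorem trace_werner_mul_kronecker (v : ℝ) (M N : Matrix (Fin 2) (Fin 2) ℂ) :
    (werner v * (M ⊗ₖ N)).trace =
      v / 2 * ∑ i, ∑ j, M i j * N i j + (1 - v) / 4 * (M.trace * N.trace) := by
  simp [Matrix.trace, Matrix.mul_apply, werner_apply, Fintype.sum_prod_type, Prod.ext_iff]
  ring

theorem trace_obsA (b : Fin 2) : (obsA b).trace = 0 := by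
  fin_cases b <;> simp [obsA, σx, σz, Matrix.trace]

theorem trace_outcomeProj {O : Matrix (Fin 2) (Fin 2) ℂ} (hO : O.trace = 0) (k : Fin 2) :
    (outcomeProj O k).trace = 1 := by
  simp [outcomeProj, hO]

theorem strategy_doA (v : ℝ) (a b : Fin 2) : (strategy v).doA a b = 1 / 2 := by
  have h := trace_werner_mul_kronecker v (outcomeProj (obsA b) a) 1
  have ht := trace_outcomeProj (trace_obsA b) a
  have hs : ∑ i, ∑ j, outcomeProj (obsA b) a i j * (1 : Matrix (Fin 2) (Fin 2) ℂ) i j = 1 := by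
    rw [← ht]
    simp [Matrix.trace, Matrix.one_apply]
  rw [hs, ht, Matrix.trace_one] at h
  have h' : (strategy v).doA a b = ((1 / 2 : ℝ) : ℂ).re := by
    unfold QuantumStrategy.doA
    congr 1
    refine h.trans ?_
    push_cast [Fintype.card_fin]
    ring
  rw [h', Complex.ofReal_re]

theorem strategy_doC (v : ℝ) (c b : Fin 2) : (strategy v).doC c b = 1 / 2 := by
  fin_cases c <;>
    simp [QuantumStrategy.doC, strategy, add_mul, ← Matrix.mul_kronecker_mul,
      Matrix.trace_kronecker, ketbra]

/-- Reading the classical bit shared by `B` and `C` selects the measurement of `B`. -/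
theorem trace_strategy (v : ℝ) (a b c : Fin 2) :
    ((strategy v).ψAB ⊗ₖ (strategy v).ψBC *
      ((strategy v).EA b a ⊗ₖ ((strategy v).EB b ⊗ₖ (strategy v).EC b c)).submatrix
        (fun p : (Fin 2 × Fin 2) × (Fin 2 × Fin 2) => (p.1.1, ((p.1.2, p.2.1), p.2.2)))
        (fun p : (Fin 2 × Fin 2) × (Fin 2 × Fin 2) => (p.1.1, ((p.1.2, p.2.1), p.2.2)))).trace
      = 1 / 2 * (werner v * (outcomeProj (obsA b) a ⊗ₖ outcomeProj (obsB c) b)).trace := by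
  simp only [strategy]
  generalize werner v = R
  generalize outcomeProj (obsA b) a = M
  generalize hN : (fun α => outcomeProj (obsB α) b) = N
  simp only [fun α => congrFun hN α]
  fin_cases c <;>
    simp [Matrix.trace, Matrix.mul_apply, Fintype.sum_prod_type, ketbra] <;>
    ring

theorem strategy_obs (v : ℝ) (a b c : Fin 2) : (strategy v).obs a b c =
    1 / 8 * (1 + v / √2 * (-1) ^ ((a : ℕ) + (b : ℕ) + (c : ℕ) * (b : ℕ))) := by
  have h : (strategy v).obs a b c =
      ((1 / 8 * (1 + v * (1 / √2) * (-1) ^ ((a : ℕ) + (b : ℕ) + (c : ℕ) * (b : ℕ))) : ℝ) : ℂ).re := by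
    unfold QuantumStrategy.obs
    congr 1
    refine (trace_strategy v a b c).trans ?_
    rw [trace_werner_mul_kronecker]
    rw [Complex.ofReal_mul, Complex.ofReal_add, Complex.ofReal_mul, Complex.ofReal_mul]
    unfold obsB
    -- Both sides are affine in `r`, so its value plays no role.
    generalize ((1 / √2 : ℝ) : ℂ) = r
    fin_cases a <;> fin_cases b <;> fin_cases c <;>
      simp [outcomeProj, obsA, σx, σz, Matrix.trace] <;> ring
  rw [h, Complex.ofReal_re, mul_one_div]

/-! ### The quadratic inequality for second-order inflations -/

/-- The expectation of a function of one row `(A, B, C)` of `Q` given `B# = s`. -/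
noncomputable def SwigTable.expect (Q : SwigTable) (s : Fin 2)
    (φ : Fin 2 → Fin 2 → Fin 2 → ℤ) : ℝ :=
  ∑ a, ∑ b, ∑ c, (φ a b c : ℝ) * Q a b c s

/-- The indicator of `A = a`. -/
def evA (a : Fin 2) : Fin 2 → Fin 2 → Fin 2 → ℤ := fun a' _ _ => if a' = a then 1 else 0

/-- The indicator of `B = b`. -/
def evB (b : Fin 2) : Fin 2 → Fin 2 → Fin 2 → ℤ := fun _ b' _ => if b' = b then 1 else 0

/-- The indicator of `A = a` and `B = b`. -/
def evAB (a b : Fin 2) : Fin 2 → Fin 2 → Fin 2 → ℤ :=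
  fun a' b' _ => if a' = a ∧ b' = b then 1 else 0

/-- The indicator of `B = b` and `C = c`. -/
def evBC (b c : Fin 2) : Fin 2 → Fin 2 → Fin 2 → ℤ :=
  fun _ b' c' => if b' = b ∧ c' = c then 1 else 0

/-- The indicator of `A = a`, `B = b` and `C = c`. -/
def evABC (a b c : Fin 2) : Fin 2 → Fin 2 → Fin 2 → ℤ :=
  fun a' b' c' => if a' = a ∧ b' = b ∧ c' = c then 1 else 0

/-- The witness as a sum of products of events of the two diagonal copies; `x s` and `y s` are the
rows `(A, B, C)` of the copies when `B# = s`. -/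
def bilinearWitness (x y : Fin 2 → Fin 2 × Fin 2 × Fin 2) : ℤ :=
  let X (s : Fin 2) (φ : Fin 2 → Fin 2 → Fin 2 → ℤ) : ℤ := φ (x s).1 (x s).2.1 (x s).2.2
  let Y (s : Fin 2) (φ : Fin 2 → Fin 2 → Fin 2 → ℤ) : ℤ := φ (y s).1 (y s).2.1 (y s).2.2
  X 0 (evA 0) * Y 0 (evA 0)
    - (2 * (X 0 (evA 0) * Y 0 (evAB 0 0)) + X 0 (evA 0) * Y 1 (evB 1)
      + X 0 (evA 0) * Y 1 (evBC 1 0) + X 0 (evA 0) * Y 1 (evABC 0 1 1)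
      - 2 * (X 0 (evA 0) * Y 1 (evABC 0 1 0)))
    + 2 * (X 1 (evAB 0 1) * Y 1 (evBC 1 0)) + X 0 (evAB 0 0) * Y 0 (evAB 1 0)
    - X 1 (evABC 0 1 0) * Y 1 (evABC 0 1 0)
    + X 0 (evAB 1 0) * Y 1 (evBC 1 0) + X 0 (evAB 1 0) * Y 1 (evABC 0 1 1)
    + X 0 (evB 0) * Y 1 (evBC 1 0) + X 0 (evB 0) * Y 1 (evABC 0 1 1)
    + Y 0 (evAB 0 0) - 2 * Y 0 (evAB 1 0) - 2 * Y 1 (evABC 0 1 0)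

/-- The bilinear witness, summed over the exchanges of the copies of the sources, is nonpositive
for every deterministic assignment; `aᵢₛ`, `bᵢⱼ`, `cⱼₛ` are the values of the twelve bits. -/
theorem bilinearWitness_symm_nonpos :
    ∀ a₀₀ a₀₁ a₁₀ a₁₁ b₀₀ b₀₁ b₁₀ b₁₁ c₀₀ c₀₁ c₁₀ c₁₁ : Fin 2,
      bilinearWitness ![(a₀₀, b₀₀, c₀₀), (a₀₁, b₀₀, c₀₁)] ![(a₁₀, b₁₁, c₁₀), (a₁₁, b₁₁, c₁₁)]
      + bilinearWitness ![(a₁₀, b₁₀, c₀₀), (a₁₁, b₁₀, c₀₁)] ![(a₀₀, b₀₁, c₁₀), (a₀₁, b₀₁, c₁₁)]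
      + bilinearWitness ![(a₀₀, b₀₁, c₁₀), (a₀₁, b₀₁, c₁₁)] ![(a₁₀, b₁₀, c₀₀), (a₁₁, b₁₀, c₀₁)]
      + bilinearWitness ![(a₁₀, b₁₁, c₁₀), (a₁₁, b₁₁, c₁₁)] ![(a₀₀, b₀₀, c₀₀), (a₀₁, b₀₀, c₀₁)]
      ≤ 0 := by
  -- There are `2^12` assignments; the events are integer-valued so that the inequality is
  -- decidable.
  decide +kernel

/-- Averages of a function of a random variable on a finite weighted space. -/
theorem sum_comp_mul {ι κ : Type*} [Fintype ι] [Fintype κ] [DecidableEq κ] (X : ι → κ)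
    (F : κ → ℝ) (q : ι → ℝ) :
    ∑ z, F (X z) * q z = ∑ x, F x * ∑ z, if X z = x then q z else 0 := by
  simp only [Finset.mul_sum]
  rw [Finset.sum_comm]
  simp

/-- The twelve bits of the second-order inflation. -/
abbrev InflationBits :=
  (Fin 2 → Fin 2 → Fin 2) × (Fin 2 → Fin 2 → Fin 2) × (Fin 2 → Fin 2 → Fin 2)

/-- The row `(A, B, C)` of the diagonal copy `i` when `B# = s`. -/
def diagRow (z : InflationBits) (i s : Fin 2) : Fin 2 × Fin 2 × Fin 2 :=
  (z.1 i s, z.2.1 i i, z.2.2 i s)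

/-- Exchange of the two copies of `γ`. -/
def exchangeγ : Equiv.Perm InflationBits :=
  Function.Involutive.toPerm
    (fun z => (fun i => z.1 (1 - i), fun i => z.2.1 (1 - i), z.2.2)) fun z => by simp

/-- Exchange of the two copies of `α`. -/
def exchangeα : Equiv.Perm InflationBits :=
  Function.Involutive.toPerm
    (fun z => (z.1, fun i j => z.2.1 i (1 - j), fun j => z.2.2 (1 - j))) fun z => by simp

theorem sum_comp_perm_mul {ι : Type*} [Fintype ι] (σ : Equiv.Perm ι) (g q : ι → ℝ)
    (hq : ∀ z, q (σ z) = q z) : ∑ z, g (σ z) * q z = ∑ z, g z * q z := by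
  rw [← Equiv.sum_comp σ fun z => g z * q z]
  simp only [hq]

/-- The four summands run over the orbit of `z` under the exchanges; their diagonal rows bring in
the off-diagonal bits `B i j` as well. -/
theorem bilinearWitness_exchange_nonpos (z : InflationBits) :
    bilinearWitness (diagRow z 0) (diagRow z 1)
      + bilinearWitness (diagRow (exchangeγ z) 0) (diagRow (exchangeγ z) 1)
      + bilinearWitness (diagRow (exchangeα z) 0) (diagRow (exchangeα z) 1)
      + bilinearWitness (diagRow (exchangeγ (exchangeα z)) 0)
        (diagRow (exchangeγ (exchangeα z)) 1) ≤ 0 :=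
  bilinearWitness_symm_nonpos (z.1 0 0) (z.1 0 1) (z.1 1 0) (z.1 1 1) (z.2.1 0 0) (z.2.1 0 1)
    (z.2.1 1 0) (z.2.1 1 1) (z.2.2 0 0) (z.2.2 0 1) (z.2.2 1 0) (z.2.2 1 1)

/-- The witness is the value of its bilinear form on two copies of `Q`. -/
theorem witness_eq_expect {Q : SwigTable} (hQ : Q.IsCondDist) :
    witness Q.obs Q.doA =
      Q.expect 0 (evA 0) * Q.expect 0 (evA 0)
    - (2 * (Q.expect 0 (evA 0) * Q.expect 0 (evAB 0 0)) + Q.expect 0 (evA 0) * Q.expect 1 (evB 1)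
      + Q.expect 0 (evA 0) * Q.expect 1 (evBC 1 0) + Q.expect 0 (evA 0) * Q.expect 1 (evABC 0 1 1)
      - 2 * (Q.expect 0 (evA 0) * Q.expect 1 (evABC 0 1 0)))
    + 2 * (Q.expect 1 (evAB 0 1) * Q.expect 1 (evBC 1 0))
    + Q.expect 0 (evAB 0 0) * Q.expect 0 (evAB 1 0)
    - Q.expect 1 (evABC 0 1 0) * Q.expect 1 (evABC 0 1 0)
    + Q.expect 0 (evAB 1 0) * Q.expect 1 (evBC 1 0)
    + Q.expect 0 (evAB 1 0) * Q.expect 1 (evABC 0 1 1)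
    + Q.expect 0 (evB 0) * Q.expect 1 (evBC 1 0) + Q.expect 0 (evB 0) * Q.expect 1 (evABC 0 1 1)
    + Q.expect 0 1 * Q.expect 0 (evAB 0 0) - 2 * (Q.expect 0 1 * Q.expect 0 (evAB 1 0))
    - 2 * (Q.expect 0 1 * Q.expect 1 (evABC 0 1 0)) := by
  -- Total mass 1 in the first copy turns the linear terms `J` into bilinear ones. Each event that
  -- fixes `B = b` is evaluated at `s = b`, where `Q` agrees with the observational table.
  have h1 : Q.expect 0 1 = 1 := by simpa [SwigTable.expect] using hQ.2 0
  rw [h1]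
  simp [SwigTable.expect, witness, witnessI, witnessE, witnessJ, margAB, margB, margBC,
    SwigTable.obs, SwigTable.doA, evA, evB, evAB, evBC, evABC]
  ring

/-- The quadratic inequality for second-order inflations. -/
theorem witness_nonpos_of_hasSecondOrderInflation {Q : SwigTable} (hQ : Q.IsCondDist)
    (h : Q.HasSecondOrderInflation) : witness Q.obs Q.doA ≤ 0 := by
  obtain ⟨q', hpos, -, hγ, hα, hdiag⟩ := h
  let q : InflationBits → ℝ := fun z => q' z.1 z.2.1 z.2.2
  -- Under `q` the two diagonal copies have the product law, so a product of expectations becomes a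
  -- single expectation.
  have hprod (s t : Fin 2) (φ ψ : Fin 2 → Fin 2 → Fin 2 → ℤ) :
      Q.expect s φ * Q.expect t ψ = ∑ z, ((φ (diagRow z 0 s).1 (diagRow z 0 s).2.1
        (diagRow z 0 s).2.2 * ψ (diagRow z 1 t).1 (diagRow z 1 t).2.1 (diagRow z 1 t).2.2 : ℤ) : ℝ)
        * q z := by
    rw [sum_comp_mul (fun z => (diagRow z 0 s, diagRow z 1 t))
      (fun x => ((φ x.1.1 x.1.2.1 x.1.2.2 * ψ x.2.1 x.2.2.1 x.2.2.2 : ℤ) : ℝ)) q]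
    have hx (x : (Fin 2 × Fin 2 × Fin 2) × (Fin 2 × Fin 2 × Fin 2)) :
        (∑ z, if (diagRow z 0 s, diagRow z 1 t) = x then q z else 0) =
          Q x.1.1 x.1.2.1 x.1.2.2 s * Q x.2.1 x.2.2.1 x.2.2.2 t := by
      rw [← hdiag]
      simp only [Fintype.sum_prod_type]
      refine Finset.sum_congr rfl fun A _ => Finset.sum_congr rfl fun B _ =>
        Finset.sum_congr rfl fun C _ => if_congr ?_ rfl rfl
      simp only [diagRow, Prod.ext_iff]
      tauto
    simp only [hx]
    have he (s : Fin 2) (φ : Fin 2 → Fin 2 → Fin 2 → ℤ) : Q.expect s φ =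
        ∑ x : Fin 2 × Fin 2 × Fin 2, (φ x.1 x.2.1 x.2.2 : ℝ) * Q x.1 x.2.1 x.2.2 s := by
      simp only [SwigTable.expect, Fintype.sum_prod_type]
    rw [he, he, Finset.sum_mul_sum]
    refine Eq.trans ?_ (Fintype.sum_prod_type _).symm
    refine Finset.sum_congr rfl fun x _ => Finset.sum_congr rfl fun y _ => ?_
    push_cast
    ring
  have hsum : witness Q.obs Q.doA =
      ∑ z, (bilinearWitness (diagRow z 0) (diagRow z 1) : ℝ) * q z := by
    rw [witness_eq_expect hQ]
    simp only [hprod]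
    simp only [Finset.mul_sum, ← Finset.sum_add_distrib, ← Finset.sum_sub_distrib]
    refine Finset.sum_congr rfl fun z _ => ?_
    simp only [bilinearWitness, Pi.one_apply]
    push_cast
    ring
  have hqγ (z : InflationBits) : q (exchangeγ z) = q z := hγ _ _ _
  have hqα (z : InflationBits) : q (exchangeα z) = q z := hα _ _ _
  let g : InflationBits → ℝ := fun z => bilinearWitness (diagRow z 0) (diagRow z 1)
  -- All four exchanges of `g` have the same `q`-mean, while their sum is pointwise nonpositive.
  have h4 : 4 * ∑ z, g z * q z ≤ 0 := by
    calc 4 * ∑ z, g z * q z = ∑ z, g z * q z + ∑ z, g (exchangeγ z) * q z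
          + ∑ z, g (exchangeα z) * q z + ∑ z, g (exchangeγ (exchangeα z)) * q z := by
          rw [sum_comp_perm_mul exchangeα (fun z => g (exchangeγ z)) q hqα,
            sum_comp_perm_mul exchangeα g q hqα, sum_comp_perm_mul exchangeγ g q hqγ]
          ring
      _ = ∑ z, (g z + g (exchangeγ z) + g (exchangeα z) + g (exchangeγ (exchangeα z))) * q z := by
          simp only [← Finset.sum_add_distrib, add_mul]
      _ ≤ 0 := Finset.sum_nonpos fun z _ => mul_nonpos_of_nonpos_of_nonneg
          (by simp only [g]; exact_mod_cast bilinearWitness_exchange_nonpos z) (hpos _ _ _)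
  rw [hsum]
  linarith

/-! ### Classical models on the interrupted graph and the Bell-type inequality -/

variable {Γ : Type u} {Λ : Type w} [MeasurableSpace Γ] [MeasurableSpace Λ]

theorem le_one_of_fin_two {p : Fin 2 → ℝ} (h0 : ∀ k, 0 ≤ p k) (h1 : ∑ k, p k = 1) (k : Fin 2) :
    p k ≤ 1 :=
  h1 ▸ Finset.single_le_sum (fun i _ => h0 i) (Finset.mem_univ k)

theorem abs_sub_le_one {p : Fin 2 → ℝ} (h0 : ∀ k, 0 ≤ p k) (h1 : ∑ k, p k = 1) :
    |p 0 - p 1| ≤ 1 := by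
  rw [Fin.sum_univ_two] at h1
  rw [abs_le]
  constructor <;> linarith [h0 0, h0 1]

/-- Write `x + y c` as the mixture of `x + y` and `x - y` with weights `(1 ± c)/2`, bound `b` times
each by the absolute value, and use `|x + y| + |x - y| ≤ 2`. The point is that the bound is affine
in `c` with a coefficient free of `b`, so it averages to 1 when `c` has mean zero and is independent
of `x, y`. -/
theorem mul_add_mul_le {b x y c : ℝ} (hb : |b| ≤ 1) (hx : |x| ≤ 1) (hy : |y| ≤ 1) (hc : |c| ≤ 1) :
    b * (x + y * c) ≤ 1 + (|x + y| - |x - y|) / 2 * c := by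
  have hmul (t : ℝ) : b * t ≤ |t| := by
    calc b * t ≤ |b| * |t| := by rw [← abs_mul]; exact le_abs_self _
      _ ≤ |t| := mul_le_of_le_one_left (abs_nonneg t) hb
  rw [abs_le] at hx hy hc
  have hsum : |x + y| + |x - y| ≤ 2 := by
    rcases abs_cases (x + y) with h | h <;> rcases abs_cases (x - y) with h' | h' <;>
      linarith [h.1, h'.1, hx.1, hx.2, hy.1, hy.2]
  have h1 := mul_le_mul_of_nonneg_left (hmul (x + y)) (by linarith : 0 ≤ (1 + c) / 2)
  have h2 := mul_le_mul_of_nonneg_left (hmul (x - y)) (by linarith : 0 ≤ (1 - c) / 2)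
  linarith

theorem integrable_of_mem_unit {X : Type*} [MeasurableSpace X] {μ : Measure X}
    [IsFiniteMeasure μ] {f : X → ℝ} (hf : Measurable f) (h0 : ∀ x, 0 ≤ f x) (h1 : ∀ x, f x ≤ 1) :
    Integrable f μ :=
  .of_bound hf.aestronglyMeasurable 1 <| .of_forall fun x => by
    rw [Real.norm_eq_abs, abs_of_nonneg (h0 x)]; exact h1 x

namespace ClassicalModel

variable (M : ClassicalModel Γ Λ)

theorem pA_le_one (b : Fin 2) (γ : Γ) (a : Fin 2) : M.pA b γ a ≤ 1 :=
  le_one_of_fin_two (M.pA_nonneg b γ) (M.pA_sum b γ) a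

theorem pB_le_one (γ : Γ) (α : Λ) (b : Fin 2) : M.pB γ α b ≤ 1 :=
  le_one_of_fin_two (M.pB_nonneg γ α) (M.pB_sum γ α) b

theorem pC_le_one (b : Fin 2) (α : Λ) (c : Fin 2) : M.pC b α c ≤ 1 :=
  le_one_of_fin_two (M.pC_nonneg b α) (M.pC_sum b α) c

/-- The joint response of `A`, `B`, `C` on the interrupted graph. -/
noncomputable def response (a b c s : Fin 2) (x : Γ × Λ) : ℝ :=
  M.pA s x.1 a * M.pB x.1 x.2 b * M.pC s x.2 c

theorem measurable_response (a b c s : Fin 2) : Measurable (M.response a b c s) :=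
  (((M.measurable_pA s a).comp measurable_fst).mul (M.measurable_pB b)).mul
    ((M.measurable_pC s c).comp measurable_snd)

theorem response_nonneg (a b c s : Fin 2) (x : Γ × Λ) : 0 ≤ M.response a b c s x :=
  mul_nonneg (mul_nonneg (M.pA_nonneg _ _ _) (M.pB_nonneg _ _ _)) (M.pC_nonneg _ _ _)

theorem response_le_one (a b c s : Fin 2) (x : Γ × Λ) : M.response a b c s x ≤ 1 :=
  mul_le_one₀ (mul_le_one₀ (M.pA_le_one _ _ _) (M.pB_nonneg _ _ _) (M.pB_le_one _ _ _))
    (M.pC_nonneg _ _ _) (M.pC_le_one _ _ _)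

theorem integrable_response (a b c s : Fin 2) :
    Integrable (M.response a b c s) ((M.μ : Measure Γ).prod (M.ν : Measure Λ)) :=
  integrable_of_mem_unit (M.measurable_response a b c s) (M.response_nonneg a b c s)
    (M.response_le_one a b c s)

theorem swig_eq_integral_response (a b c s : Fin 2) :
    M.swig a b c s = ∫ x, M.response a b c s x ∂(M.μ : Measure Γ).prod (M.ν : Measure Λ) :=
  (integral_prod _ (M.integrable_response a b c s)).symm

/-- On the interrupted graph `A` and `C` are independent. -/
theorem swig_doAC_eq (a c s : Fin 2) : M.swig.doAC a c s =
    (∫ γ, M.pA s γ a ∂(M.μ : Measure Γ)) * ∫ α, M.pC s α c ∂(M.ν : Measure Λ) := by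
  unfold SwigTable.doAC
  simp only [swig_eq_integral_response]
  rw [← integral_finsetSum _ fun b _ => M.integrable_response a b c s, ← integral_prod_mul]
  congr 1
  ext x
  simp only [response, ← Finset.sum_mul, ← Finset.mul_sum, M.pB_sum, mul_one]

theorem integrable_pA (s a : Fin 2) : Integrable (fun γ => M.pA s γ a) (M.μ : Measure Γ) :=
  integrable_of_mem_unit (M.measurable_pA s a) (M.pA_nonneg s · a) (M.pA_le_one s · a)

theorem integrable_pC (s c : Fin 2) : Integrable (fun α => M.pC s α c) (M.ν : Measure Λ) :=
  integrable_of_mem_unit (M.measurable_pC s c) (M.pC_nonneg s · c) (M.pC_le_one s · c)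

theorem sum_integral_pA (s : Fin 2) : ∑ a, ∫ γ, M.pA s γ a ∂(M.μ : Measure Γ) = 1 := by
  rw [← integral_finsetSum _ fun a _ => M.integrable_pA s a]
  simp [M.pA_sum]

theorem sum_integral_pC (s : Fin 2) : ∑ c, ∫ α, M.pC s α c ∂(M.ν : Measure Λ) = 1 := by
  rw [← integral_finsetSum _ fun c _ => M.integrable_pC s c]
  simp [M.pC_sum]

theorem swig_doA_eq (a s : Fin 2) : M.swig.doA a s = ∫ γ, M.pA s γ a ∂(M.μ : Measure Γ) := by
  have h : M.swig.doA a s = ∑ c, M.swig.doAC a c s := Finset.sum_comm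
  simp only [h, swig_doAC_eq, ← Finset.mul_sum, sum_integral_pC, mul_one]

theorem swig_doC_eq (c s : Fin 2) : M.swig.doC c s = ∫ α, M.pC s α c ∂(M.ν : Measure Λ) := by
  have h : M.swig.doC c s = ∑ a, M.swig.doAC a c s := rfl
  simp only [h, swig_doAC_eq, ← Finset.sum_mul, sum_integral_pA, one_mul]

theorem swig_isCondDist : M.swig.IsCondDist := by
  refine ⟨fun a b c s => ?_, fun s => ?_⟩
  · rw [swig_eq_integral_response]
    exact integral_nonneg (M.response_nonneg a b c s)
  · calc ∑ a, ∑ b, ∑ c, M.swig a b c s = ∑ a, M.swig.doA a s := rfl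
      _ = 1 := by simp only [swig_doA_eq, sum_integral_pA]

/-- A Bell-type inequality: when `C` is unbiased for `B# = 1`, it acts as a random setting
for `B`. -/
theorem bell_inequality (hC : M.swig.doC 0 1 = M.swig.doC 1 1) :
    ∑ a : Fin 2, ∑ b : Fin 2, ∑ c : Fin 2, ((-1) ^ ((a : ℕ) + (b : ℕ)) * M.swig a b c 0
      + (-1) ^ ((a : ℕ) + (b : ℕ) + (c : ℕ)) * M.swig a b c 1) ≤ 1 := by
  set ρ := (M.μ : Measure Γ).prod (M.ν : Measure Λ)
  let x (s : Fin 2) (γ : Γ) : ℝ := M.pA s γ 0 - M.pA s γ 1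
  let y (α : Λ) : ℝ := M.pC 1 α 0 - M.pC 1 α 1
  -- The coefficient of `c` in `mul_add_mul_le`. It depends on `γ` alone, so the integral of `g * y`
  -- factorizes and vanishes with the mean of `y`.
  let g (γ : Γ) : ℝ := (|x 0 γ + x 1 γ| - |x 0 γ - x 1 γ|) / 2
  have hy : ∫ α, y α ∂(M.ν : Measure Λ) = 0 := by
    rw [integral_sub (M.integrable_pC 1 0) (M.integrable_pC 1 1), ← swig_doC_eq, ← swig_doC_eq, hC,
      sub_self]
  have hx (s : Fin 2) : Integrable (x s) (M.μ : Measure Γ) :=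
    (M.integrable_pA s 0).sub (M.integrable_pA s 1)
  have hg : Integrable g (M.μ : Measure Γ) :=
    (((hx 0).add (hx 1)).abs.sub ((hx 0).sub (hx 1)).abs).div_const 2
  have hyi : Integrable y (M.ν : Measure Λ) := (M.integrable_pC 1 0).sub (M.integrable_pC 1 1)
  have hgy : Integrable (fun z : Γ × Λ => g z.1 * y z.2) ρ := hg.mul_prod hyi
  have hi (a b c : Fin 2) : Integrable (fun z =>
      (-1) ^ ((a : ℕ) + (b : ℕ)) * M.response a b c 0 z
        + (-1) ^ ((a : ℕ) + (b : ℕ) + (c : ℕ)) * M.response a b c 1 z) ρ :=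
    ((M.integrable_response a b c 0).const_mul _).add ((M.integrable_response a b c 1).const_mul _)
  have hpt (z : Γ × Λ) : ∑ a : Fin 2, ∑ b : Fin 2, ∑ c : Fin 2,
      ((-1) ^ ((a : ℕ) + (b : ℕ)) * M.response a b c 0 z
        + (-1) ^ ((a : ℕ) + (b : ℕ) + (c : ℕ)) * M.response a b c 1 z) ≤ 1 + g z.1 * y z.2 := by
    have hA (s : Fin 2) : |x s z.1| ≤ 1 := abs_sub_le_one (M.pA_nonneg s z.1) (M.pA_sum s z.1)
    have hB : |M.pB z.1 z.2 0 - M.pB z.1 z.2 1| ≤ 1 :=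
      abs_sub_le_one (M.pB_nonneg z.1 z.2) (M.pB_sum z.1 z.2)
    have hC : |y z.2| ≤ 1 := abs_sub_le_one (M.pC_nonneg 1 z.2) (M.pC_sum 1 z.2)
    refine le_trans (le_of_eq ?_) (mul_add_mul_le hB (hA 0) (hA 1) hC)
    -- In the `s = 0` term no sign depends on `c`, so `C` sums out.
    have h0 := M.pC_sum 0 z.2
    simp only [Fin.sum_univ_two] at h0 ⊢
    simp [response, x, y]
    linear_combination (M.pA 0 z.1 0 - M.pA 0 z.1 1) * (M.pB z.1 z.2 0 - M.pB z.1 z.2 1) * h0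
  calc _ = ∫ z, ∑ a : Fin 2, ∑ b : Fin 2, ∑ c : Fin 2,
      ((-1) ^ ((a : ℕ) + (b : ℕ)) * M.response a b c 0 z
        + (-1) ^ ((a : ℕ) + (b : ℕ) + (c : ℕ)) * M.response a b c 1 z) ∂ρ := by
        simp only [swig_eq_integral_response]
        rw [integral_finsetSum _ fun a _ => integrable_finsetSum _ fun b _ =>
          integrable_finsetSum _ fun c _ => hi a b c]
        refine Finset.sum_congr rfl fun a _ => ?_
        rw [integral_finsetSum _ fun b _ => integrable_finsetSum _ fun c _ => hi a b c]
        refine Finset.sum_congr rfl fun b _ => ?_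
        rw [integral_finsetSum _ fun c _ => hi a b c]
        refine Finset.sum_congr rfl fun c _ => ?_
        rw [integral_add ((M.integrable_response a b c 0).const_mul _)
          ((M.integrable_response a b c 1).const_mul _), integral_const_mul, integral_const_mul]
    _ ≤ ∫ z, (1 + g z.1 * y z.2) ∂ρ :=
        integral_mono (integrable_finsetSum _ fun a _ => integrable_finsetSum _ fun b _ =>
          integrable_finsetSum _ fun c _ => hi a b c) ((integrable_const 1).add hgy) hpt
    _ = 1 := by
        rw [integral_add (integrable_const 1) hgy, integral_prod_mul, hy]
        simp

end ClassicalModel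

/-! ### Second-order inflation of a classical model -/

theorem sum_prod_prod_eq (g : Fin 2 → Fin 2 → Fin 2 → ℝ) :
    ∑ F : Fin 2 → Fin 2 → Fin 2, ∏ i, ∏ j, g i j (F i j) = ∏ i, ∏ j, ∑ k, g i j k := by
  simp only [Fintype.prod_sum]

/-- Marginal on two bits of a product distribution on four bits. -/
theorem sum_ite_prod_eq {p : Fin 2 → Fin 2 → Fin 2 → ℝ} (hp : ∀ i s, ∑ k, p i s k = 1)
    (s t a b : Fin 2) :
    (∑ F : Fin 2 → Fin 2 → Fin 2,
      if F 0 s = a ∧ F 1 t = b then ∏ i, ∏ j, p i j (F i j) else 0) = p 0 s a * p 1 t b := by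
  -- Distributing the constraint as one indicator per bit lets the sum factorize; the unconstrained
  -- bits contribute 1.
  calc _ = ∑ F : Fin 2 → Fin 2 → Fin 2, ∏ i, ∏ j, (p i j (F i j) *
        if (i = 0 → j = s → F i j = a) ∧ (i = 1 → j = t → F i j = b) then 1 else 0) := by
        refine Finset.sum_congr rfl fun F _ => ?_
        simp only [Finset.prod_mul_distrib, Finset.prod_ite_zero, Finset.prod_const_one]
        rw [mul_ite, mul_one, mul_zero]
        refine if_congr ?_ rfl rfl
        fin_cases s <;> fin_cases t <;> simp [Fin.forall_fin_two]
    _ = _ := by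
        rw [sum_prod_prod_eq fun i j k => p i j k *
          if (i = 0 → j = s → k = a) ∧ (i = 1 → j = t → k = b) then 1 else 0]
        have h00 := hp 0 0
        have h01 := hp 0 1
        have h10 := hp 1 0
        have h11 := hp 1 1
        simp only [Fin.prod_univ_two, Fin.sum_univ_two] at *
        fin_cases s <;> fin_cases t <;> fin_cases a <;> fin_cases b <;> simp [*]

namespace ClassicalModel

variable (M : ClassicalModel Γ Λ)

/-- The joint response of the twelve bits of the second-order inflation, given two copies
`z.1` of `γ` and two copies `z.2` of `α`. -/
noncomputable def inflationResponse (A B C : Fin 2 → Fin 2 → Fin 2) (z : (Γ × Γ) × (Λ × Λ)) : ℝ :=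
  (∏ i, ∏ s, M.pA s (![z.1.1, z.1.2] i) (A i s)) *
    (∏ i, ∏ j, M.pB (![z.1.1, z.1.2] i) (![z.2.1, z.2.2] j) (B i j)) *
    ∏ j, ∏ s, M.pC s (![z.2.1, z.2.2] j) (C j s)

theorem inflationResponse_nonneg (A B C : Fin 2 → Fin 2 → Fin 2) (z : (Γ × Γ) × (Λ × Λ)) :
    0 ≤ M.inflationResponse A B C z :=
  mul_nonneg (mul_nonneg
    (Finset.prod_nonneg fun _ _ => Finset.prod_nonneg fun _ _ => M.pA_nonneg _ _ _)
    (Finset.prod_nonneg fun _ _ => Finset.prod_nonneg fun _ _ => M.pB_nonneg _ _ _))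
    (Finset.prod_nonneg fun _ _ => Finset.prod_nonneg fun _ _ => M.pC_nonneg _ _ _)

theorem inflationResponse_le_one (A B C : Fin 2 → Fin 2 → Fin 2) (z : (Γ × Γ) × (Λ × Λ)) :
    M.inflationResponse A B C z ≤ 1 := by
  have h {p : Fin 2 → Fin 2 → ℝ} (h0 : ∀ i j, 0 ≤ p i j) (h1 : ∀ i j, p i j ≤ 1) :
      ∏ i, ∏ j, p i j ≤ 1 :=
    Finset.prod_le_one (fun i _ => Finset.prod_nonneg fun j _ => h0 i j)
      fun i _ => Finset.prod_le_one (fun j _ => h0 i j) fun j _ => h1 i j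
  exact mul_le_one₀ (mul_le_one₀
    (h (fun _ _ => M.pA_nonneg _ _ _) fun _ _ => M.pA_le_one _ _ _)
    (Finset.prod_nonneg fun _ _ => Finset.prod_nonneg fun _ _ => M.pB_nonneg _ _ _)
    (h (fun _ _ => M.pB_nonneg _ _ _) fun _ _ => M.pB_le_one _ _ _))
    (Finset.prod_nonneg fun _ _ => Finset.prod_nonneg fun _ _ => M.pC_nonneg _ _ _)
    (h (fun _ _ => M.pC_nonneg _ _ _) fun _ _ => M.pC_le_one _ _ _)

theorem measurable_inflationResponse (A B C : Fin 2 → Fin 2 → Fin 2) :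
    Measurable (M.inflationResponse A B C) := by
  have hγ (i : Fin 2) : Measurable fun z : (Γ × Γ) × (Λ × Λ) => ![z.1.1, z.1.2] i := by
    fin_cases i
    exacts [measurable_fst.comp measurable_fst, measurable_snd.comp measurable_fst]
  have hα (j : Fin 2) : Measurable fun z : (Γ × Γ) × (Λ × Λ) => ![z.2.1, z.2.2] j := by
    fin_cases j
    exacts [measurable_fst.comp measurable_snd, measurable_snd.comp measurable_snd]
  refine ((Finset.measurable_fun_prod _ fun i _ => Finset.measurable_fun_prod _ fun s _ =>
    (M.measurable_pA s _).comp (hγ i)).mul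
    (Finset.measurable_fun_prod _ fun i _ => Finset.measurable_fun_prod _ fun j _ =>
    (M.measurable_pB _).comp ((hγ i).prodMk (hα j)))).mul
    (Finset.measurable_fun_prod _ fun j _ => Finset.measurable_fun_prod _ fun s _ =>
    (M.measurable_pC s _).comp (hα j))

/-- The law of two copies of each source. -/
noncomputable abbrev twoCopies : Measure ((Γ × Γ) × (Λ × Λ)) :=
  ((M.μ : Measure Γ).prod (M.μ : Measure Γ)).prod ((M.ν : Measure Λ).prod (M.ν : Measure Λ))

theorem integrable_inflationResponse (A B C : Fin 2 → Fin 2 → Fin 2) :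
    Integrable (M.inflationResponse A B C) M.twoCopies :=
  integrable_of_mem_unit (M.measurable_inflationResponse A B C)
    (M.inflationResponse_nonneg A B C) (M.inflationResponse_le_one A B C)

/-- The marginal of the inflation on its diagonal copies. -/
theorem sum_ite_inflationResponse (s₀ s₁ a₀ a₁ b₀ b₁ c₀ c₁ : Fin 2) (z : (Γ × Γ) × (Λ × Λ)) :
    (∑ A, ∑ B, ∑ C,
      if A 0 s₀ = a₀ ∧ A 1 s₁ = a₁ ∧ B 0 0 = b₀ ∧ B 1 1 = b₁ ∧ C 0 s₀ = c₀ ∧ C 1 s₁ = c₁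
      then M.inflationResponse A B C z else 0) =
      M.response a₀ b₀ c₀ s₀ (z.1.1, z.2.1) * M.response a₁ b₁ c₁ s₁ (z.1.2, z.2.2) := by
  have hA := sum_ite_prod_eq (p := fun i s => M.pA s (![z.1.1, z.1.2] i))
    (fun i s => M.pA_sum _ _) s₀ s₁ a₀ a₁
  have hB := sum_ite_prod_eq (p := fun i j => M.pB (![z.1.1, z.1.2] i) (![z.2.1, z.2.2] j))
    (fun i s => M.pB_sum _ _) 0 1 b₀ b₁
  have hC := sum_ite_prod_eq (p := fun i s => M.pC s (![z.2.1, z.2.2] i))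
    (fun i s => M.pC_sum _ _) s₀ s₁ c₀ c₁
  calc _ = (∑ A : Fin 2 → Fin 2 → Fin 2, if A 0 s₀ = a₀ ∧ A 1 s₁ = a₁ then
          ∏ i, ∏ s, M.pA s (![z.1.1, z.1.2] i) (A i s) else 0) *
        (∑ B : Fin 2 → Fin 2 → Fin 2, if B 0 0 = b₀ ∧ B 1 1 = b₁ then
          ∏ i, ∏ j, M.pB (![z.1.1, z.1.2] i) (![z.2.1, z.2.2] j) (B i j) else 0) *
        (∑ C : Fin 2 → Fin 2 → Fin 2, if C 0 s₀ = c₀ ∧ C 1 s₁ = c₁ then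
          ∏ j, ∏ s, M.pC s (![z.2.1, z.2.2] j) (C j s) else 0) := by
        rw [Finset.sum_mul_sum, Finset.sum_mul]
        refine Finset.sum_congr rfl fun A _ => ?_
        rw [Finset.sum_mul_sum]
        refine Finset.sum_congr rfl fun B _ => Finset.sum_congr rfl fun C _ => ?_
        unfold inflationResponse
        rw [ite_zero_mul_ite_zero, ite_zero_mul_ite_zero]
        simp only [and_assoc]
    _ = _ := by
        rw [hA, hB, hC]
        simp [response]
        ring

theorem sum_inflationResponse (z : (Γ × Γ) × (Λ × Λ)) :
    ∑ A, ∑ B, ∑ C, M.inflationResponse A B C z = 1 := by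
  simp only [inflationResponse, ← Finset.mul_sum, ← Finset.sum_mul]
  rw [sum_prod_prod_eq fun i s => M.pA s (![z.1.1, z.1.2] i),
    sum_prod_prod_eq fun i j => M.pB (![z.1.1, z.1.2] i) (![z.2.1, z.2.2] j),
    sum_prod_prod_eq fun j s => M.pC s (![z.2.1, z.2.2] j)]
  simp only [M.pA_sum, M.pB_sum, M.pC_sum, Finset.prod_const_one, mul_one]

/-- Independent copies of the sources of a classical model give a second-order inflation. -/
theorem hasSecondOrderInflation : M.swig.HasSecondOrderInflation := by
  have hI (A B C : Fin 2 → Fin 2 → Fin 2) := M.integrable_inflationResponse A B C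
  have hdiag (s₀ s₁ a₀ a₁ b₀ b₁ c₀ c₁ : Fin 2) : (∑ A, ∑ B, ∑ C,
      if A 0 s₀ = a₀ ∧ A 1 s₁ = a₁ ∧ B 0 0 = b₀ ∧ B 1 1 = b₁ ∧ C 0 s₀ = c₀ ∧ C 1 s₁ = c₁
      then ∫ z, M.inflationResponse A B C z ∂M.twoCopies else 0) =
      M.swig a₀ b₀ c₀ s₀ * M.swig a₁ b₁ c₁ s₁ := by
    have hite (A B C : Fin 2 → Fin 2 → Fin 2) (p : Prop) [Decidable p] :
        Integrable (fun z => if p then M.inflationResponse A B C z else 0) M.twoCopies := by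
      split_ifs
      exacts [hI A B C, integrable_zero _ _ _]
    have hint (A B C : Fin 2 → Fin 2 → Fin 2) (p : Prop) [Decidable p] :
        (if p then ∫ z, M.inflationResponse A B C z ∂M.twoCopies else 0) =
          ∫ z, (if p then M.inflationResponse A B C z else 0) ∂M.twoCopies := by
      split_ifs <;> simp
    simp only [hint]
    have hsum := M.sum_ite_inflationResponse s₀ s₁ a₀ a₁ b₀ b₁ c₀ c₁
    calc _ = ∫ z, M.response a₀ b₀ c₀ s₀ (z.1.1, z.2.1) * M.response a₁ b₁ c₁ s₁ (z.1.2, z.2.2)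
          ∂M.twoCopies := by
          simp only [← hsum]
          rw [integral_finsetSum _ fun A _ => integrable_finsetSum _ fun B _ =>
            integrable_finsetSum _ fun C _ => hite A B C _]
          refine Finset.sum_congr rfl fun A _ => ?_
          rw [integral_finsetSum _ fun B _ => integrable_finsetSum _ fun C _ => hite A B C _]
          refine Finset.sum_congr rfl fun B _ => ?_
          rw [integral_finsetSum _ fun C _ => hite A B C _]
      _ = _ := by
          -- The first response involves only the first copies of `γ` and `α`, the second only the
          -- second copies, so the integral splits over `α` and then over `γ`.
          rw [integral_prod]
          · have h (g : Γ × Γ) := integral_prod_mul (μ := (M.ν : Measure Λ)) (ν := (M.ν : Measure Λ))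
              (fun α => M.response a₀ b₀ c₀ s₀ (g.1, α)) (fun α => M.response a₁ b₁ c₁ s₁ (g.2, α))
            simp only [h]
            exact integral_prod_mul (fun γ => ∫ α, M.response a₀ b₀ c₀ s₀ (γ, α) ∂(M.ν : Measure Λ))
              (fun γ => ∫ α, M.response a₁ b₁ c₁ s₁ (γ, α) ∂(M.ν : Measure Λ))
          · simp only [← hsum]
            exact integrable_finsetSum _ fun A _ => integrable_finsetSum _ fun B _ =>
              integrable_finsetSum _ fun C _ => hite A B C _
  refine ⟨fun A B C => ∫ z, M.inflationResponse A B C z ∂M.twoCopies, fun A B C => ?_, ?_,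
    fun A B C => ?_, fun A B C => ?_, hdiag⟩
  · exact integral_nonneg (M.inflationResponse_nonneg A B C)
  · calc _ = ∫ z, ∑ A, ∑ B, ∑ C, M.inflationResponse A B C z ∂M.twoCopies := by
          rw [integral_finsetSum _ fun A _ => integrable_finsetSum _ fun B _ =>
            integrable_finsetSum _ fun C _ => hI A B C]
          refine Finset.sum_congr rfl fun A _ => ?_
          rw [integral_finsetSum _ fun B _ => integrable_finsetSum _ fun C _ => hI A B C]
          refine Finset.sum_congr rfl fun B _ => ?_
          rw [integral_finsetSum _ fun C _ => hI A B C]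
      _ = 1 := by simp [M.sum_inflationResponse]
  · beta_reduce
    rw [integral_prod _ (hI _ _ _), integral_prod _ (hI _ _ _)]
    -- Relabelling `i` amounts to swapping the two copies of `γ`, which preserves their product law.
    rw [← integral_prod_swap]
    congr 1; ext g; congr 1; ext l
    simp [inflationResponse, -mul_eq_mul_right_iff, -mul_eq_mul_left_iff]
    ring
  · beta_reduce
    rw [integral_prod _ (hI _ _ _), integral_prod _ (hI _ _ _)]
    congr 1; ext g
    rw [← integral_prod_swap]
    congr 1; ext l
    simp [inflationResponse, -mul_eq_mul_right_iff, -mul_eq_mul_left_iff]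
    ring

end ClassicalModel

/-! ### Non-classicality of the strategy from data fusion -/

theorem half_lt_div_sqrt_two {v : ℝ} (hv : 1 / √2 < v) : 1 / 2 < v / √2 := by
  have h2 : (0 : ℝ) < √2 := by positivity
  rw [lt_div_iff₀ h2]
  calc 1 / 2 * √2 = 1 / √2 := by
        field_simp
        norm_num
    _ < v := hv

/-- The tables of the strategy have no joint classical explanation for `v > 1 / √2`. -/
theorem strategy_joint_nonclassical {v : ℝ} (hv : 1 / √2 < v) :
    ¬ ∃ Q : SwigTable, SwigTable.IsClassical.{u, w} Q ∧ Q.obs = (strategy v).obs ∧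
      Q.doA = (strategy v).doA ∧ Q.doC = (strategy v).doC := by
  rintro ⟨_, ⟨Γ, Λ, _, _, M, rfl⟩, hobs, hA, hC⟩
  have hO (a b c : Fin 2) : M.swig a b c b =
      1 / 8 * (1 + v / √2 * (-1) ^ ((a : ℕ) + (b : ℕ) + (c : ℕ) * (b : ℕ))) := by
    rw [← strategy_obs, ← hobs]; rfl
  have hA' (a s : Fin 2) : M.swig.doA a s = 1 / 2 := by rw [hA, strategy_doA]
  have hC' (c s : Fin 2) : M.swig.doC c s = 1 / 2 := by rw [hC, strategy_doC]
  -- At `s = 1` this determines the unobserved entries `Q(a,0,c|1)`.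
  have hAC (a c s : Fin 2) : M.swig.doAC a c s = 1 / 4 := by
    rw [M.swig_doAC_eq, ← M.swig_doA_eq, ← M.swig_doC_eq, hA', hC']; norm_num
  have hbell := M.bell_inequality ((hC' 0 1).trans (hC' 1 1).symm)
  have hw := half_lt_div_sqrt_two hv
  generalize v / √2 = w at hO hw
  have hA0 := hA' 0 0
  have hA1 := hA' 1 0
  simp only [SwigTable.doA, SwigTable.doAC, Fin.sum_univ_two] at hbell hA0 hA1 hAC
  have h000 := hO 0 0 0
  have h001 := hO 0 0 1
  have h100 := hO 1 0 0
  have h101 := hO 1 0 1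
  have h010 := hO 0 1 0
  have h011 := hO 0 1 1
  have h110 := hO 1 1 0
  have h111 := hO 1 1 1
  norm_num at h000 h001 h100 h101 h010 h011 h110 h111 hbell
  -- Each value of `s` contributes `w` to the Bell expression, so `hbell` reads `2 w ≤ 1`, against
  -- `hw`.
  linarith [hAC 0 0 1, hAC 0 1 1, hAC 1 0 1, hAC 1 1 1]

/-- The law of a uniform bit. -/
noncomputable def uniformBit : ProbabilityMeasure (Fin 2) :=
  ⟨(PMF.uniformOfFintype (Fin 2)).toMeasure, inferInstance⟩

theorem integral_uniformBit (f : Fin 2 → ℝ) :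
    ∫ x, f x ∂(uniformBit : Measure (Fin 2)) = (f 0 + f 1) / 2 := by
  have h : (uniformBit : Measure (Fin 2)) = (PMF.uniformOfFintype (Fin 2)).toMeasure := rfl
  rw [h, PMF.integral_eq_sum]
  simp
  ring

/-- The model in which all responses are independent uniform bits. -/
noncomputable def uniformModel : ClassicalModel (Fin 2) (Fin 2) where
  μ := uniformBit
  ν := uniformBit
  pA _ _ _ := 1 / 2
  pB _ _ _ := 1 / 2
  pC _ _ _ := 1 / 2
  measurable_pA _ _ := measurable_const
  measurable_pB _ := measurable_const
  measurable_pC _ _ := measurable_const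
  pA_nonneg _ _ _ := by norm_num
  pB_nonneg _ _ _ := by norm_num
  pC_nonneg _ _ _ := by norm_num
  pA_sum _ _ := by norm_num
  pB_sum _ _ := by norm_num
  pC_sum _ _ := by norm_num

theorem uniformModel_doA (a s : Fin 2) : uniformModel.swig.doA a s = 1 / 2 := by
  simp [ClassicalModel.swig_doA_eq, uniformModel]

theorem uniformModel_doC (c s : Fin 2) : uniformModel.swig.doC c s = 1 / 2 := by
  simp [ClassicalModel.swig_doC_eq, uniformModel]

/-- A model with uniform bits `γ`, `α`, selected by `B` so as to correlate `A = γ` and `C = α`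
given `B = 1`; given `B = 0`, `A` is a biased and `C` an unbiased bit. -/
noncomputable def selectionModel (t : ℝ) (h0 : 0 ≤ t) (h1 : t ≤ 1) :
    ClassicalModel (Fin 2) (Fin 2) where
  μ := uniformBit
  ν := uniformBit
  pA b γ a := if b = 0 then (1 + t * (-1) ^ (a : ℕ)) / 2 else if a = γ then 1 else 0
  pB γ α b := (1 + t * (-1) ^ ((γ : ℕ) + (α : ℕ) + (b : ℕ))) / 2
  pC b α c := if b = 0 then 1 / 2 else if c = α then 1 else 0
  measurable_pA _ _ := .of_discrete
  measurable_pB _ := .of_discrete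
  measurable_pC _ _ := .of_discrete
  pA_nonneg b γ a := by
    rcases neg_one_pow_eq_or ℝ (a : ℕ) with h | h <;> rw [h] <;> split_ifs <;> linarith
  pB_nonneg γ α b := by
    rcases neg_one_pow_eq_or ℝ ((γ : ℕ) + (α : ℕ) + (b : ℕ)) with h | h <;> rw [h] <;> linarith
  pC_nonneg b α c := by split_ifs <;> norm_num
  pA_sum b γ := by
    by_cases hb : b = 0 <;> simp [hb]
    ring
  pB_sum γ α := by simp [pow_succ]; ring
  pC_sum b α := by by_cases hb : b = 0 <;> simp [hb]

theorem selectionModel_obs (t : ℝ) (h0 : 0 ≤ t) (h1 : t ≤ 1) (a b c : Fin 2) :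
    (selectionModel t h0 h1).obs a b c =
      1 / 8 * (1 + t * (-1) ^ ((a : ℕ) + (b : ℕ) + (c : ℕ) * (b : ℕ))) := by
  simp only [ClassicalModel.obs, selectionModel, integral_uniformBit]
  fin_cases a <;> fin_cases b <;> fin_cases c <;> simp <;> ring

/-- The tables of the strategy are non-classical from data fusion for `v > 1 / √2`. -/
theorem strategy_nonClassicalFusion {v : ℝ} (h : 1 / √2 < v) (h1 : v ≤ 1) :
    NonClassicalFusion.{u, w} (strategy v).obs (strategy v).doA (strategy v).doC where
  obs_classical := by
    have h2 : (1 : ℝ) ≤ √2 := Real.one_le_sqrt.2 (by norm_num)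
    have h0 : 0 ≤ v / √2 := by linarith [half_lt_div_sqrt_two h]
    have hle : v / √2 ≤ 1 := by
      rw [div_le_one (by positivity)]
      linarith
    refine ⟨2, 2, selectionModel (v / √2) h0 hle, ?_⟩
    ext a b c
    rw [selectionModel_obs, strategy_obs]
  doA_classical := ⟨2, 2, uniformModel, by ext a s; rw [uniformModel_doA, strategy_doA]⟩
  doC_classical := ⟨2, 2, uniformModel, by ext c s; rw [uniformModel_doC, strategy_doC]⟩
  doAC_classical := ⟨2, 2, uniformModel, fun a c s => by
    rw [ClassicalModel.swig_doAC_eq, ← ClassicalModel.swig_doA_eq, ← ClassicalModel.swig_doC_eq,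
      uniformModel_doA, uniformModel_doC, strategy_doA, strategy_doC]⟩
  joint_nonclassical := strategy_joint_nonclassical h

/-! ### Violation of the quadratic inequality -/

theorem witness_strategy_one :
    witness (strategy 1).obs (strategy 1).doA = (38 * √2 - 53) / 128 := by
  have h2 : √2 * √2 = 2 := Real.mul_self_sqrt (by norm_num)
  have hinv : 1 / √2 = √2 / 2 := by
    rw [div_eq_div_iff (by positivity) (by norm_num), h2, one_mul]
  simp only [witness, witnessI, witnessE, witnessJ, margAB, margB, margBC, strategy_obs,
    strategy_doA, Fin.sum_univ_two, hinv]
  simp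
  linear_combination -7 / 256 * h2

end UC

theorem theorem1 :
    -- the strategy is a quantum strategy and produces the stated tables
    (∀ v : ℝ, 0 ≤ v → v ≤ 1 →
      (UC.strategy v).IsValid ∧
      (∀ a b c : Fin 2, (UC.strategy v).obs a b c =
        1 / 8 * (1 + v / √2 * (-1) ^ ((a : ℕ) + (b : ℕ) + (c : ℕ) * (b : ℕ)))) ∧
      (∀ a b : Fin 2, (UC.strategy v).doA a b = 1 / 2) ∧
      (∀ c b : Fin 2, (UC.strategy v).doC c b = 1 / 2)) ∧
    -- non-classicality from data fusion
    (∀ v : ℝ, 1 / √2 < v → v ≤ 1 →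
      UC.NonClassicalFusion.{u, w} (UC.strategy v).obs (UC.strategy v).doA
        (UC.strategy v).doC) ∧
    -- the quadratic inequality holds classically, already for second-order inflations,
    -- and is violated at `v = 1`
    (∀ (Γ : Type u) (Λ : Type w) [MeasurableSpace Γ] [MeasurableSpace Λ]
      (M : UC.ClassicalModel Γ Λ), UC.witness M.obs M.swig.doA ≤ 0) ∧
    (∀ Q : UC.SwigTable, Q.IsCondDist → Q.HasSecondOrderInflation →
      UC.witness Q.obs Q.doA ≤ 0) ∧
    UC.witness (UC.strategy 1).obs (UC.strategy 1).doA = (38 * √2 - 53) / 128 ∧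
    0 < (38 * √2 - 53) / 128 := by
  exact ⟨fun v h0 h1 => ⟨UC.strategy_isValid h0 h1, UC.strategy_obs v, UC.strategy_doA v,
      UC.strategy_doC v⟩,
    fun v h h1 => UC.strategy_nonClassicalFusion h h1,
    fun Γ Λ _ _ M => UC.witness_nonpos_of_hasSecondOrderInflation M.swig_isCondDist
      M.hasSecondOrderInflation,
    fun Q hQ h => UC.witness_nonpos_of_hasSecondOrderInflation hQ h,
    UC.witness_strategy_one, by
      -- This precision suffices, since `38 * 1.4 = 53.2 > 53`.
      have h : (1.4 : ℝ) < √2 := Real.lt_sqrt_of_sq_lt (by norm_num)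
      linarith⟩
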